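/- Let $\mathbb{H}$ be the quaternions and let $\mathcal{S}_{\mathbb{H}}(\mathbb{R})$ be the space of smooth functions $\psi:\mathbb{R}\to\mathbb{H}$ with $\sup_{x\in\mathbb{R}}|x^\alpha\psi^{(\beta)}(x)|<\infty$ for all $\alpha,\beta\in\mathbb{N}$. For $\psi\in\mathcal{S}_{\mathbb{H}}(\mathbb{R})$ let $$\mathcal{B}_{\mathbb{H}}^S(\psi)(q)=\pi^{-3/4}\int_{\mathbb{R}}e^{-\frac12(q^2+x^2)+\sqrt2\,qx}\,\psi(x)\,dx,\qquad q\in\mathbb{H},$$ be its quaternionic Segal--Bargmann transform (with parameter $\nu=1$), and let $\mathcal{SF}(\mathbb{H})=\{\mathcal{B}_{\mathbb{H}}^S(\psi):\psi\in\mathcal{S}_{\mathbb{H}}(\mathbb{R})\}$. A real differentiable function $f:\mathbb{H}\to\mathbb{H}$ is called slice regular if, for every $I\in\mathbb{H}$ with $I^2=-1$, the function $(x,y)\mapsto f(x+Iy)$ on $\mathbb{R}^2$ is continuously differentiable and satisfies $\frac12\left(\frac{\partial}{\partial x}+I\frac{\partial}{\partial y}\right)f(x+Iy)=0$. For a sequence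 $(c_k)_{k\ge0}$ in $\mathbb{H}$ consider the condition $$(\ast)\qquad \sup_{k\in\mathbb{N}}|c_k|\,k^p\sqrt{k!}<\infty\quad\text{for all real }p>0 .$$ Theorem. (1) If $(c_k)$ satisfies $(\ast)$, then $\sum_{k=0}^\infty q^kc_k$ converges for every $q\in\mathbb{H}$. (2) If $f(q)=\sum_{k=0}^\infty q^kc_k$, with the series converging for every $q\in\mathbb{H}$, then $f\in\mathcal{SF}(\mathbb{H})$ if and only if $(c_k)$ satisfies $(\ast)$. (3) $\mathcal{SF}(\mathbb{H})$ is exactly the set of slice regular functions $f:\mathbb{H}\to\mathbb{H}$ of the form $f(q)=\sum_{k=0}^\infty q^kc_k$ for all $q\in\mathbb{H}$, with coefficients $c_k\in\mathbb{H}$ satisfying $(\ast)$. -/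

import Mathlib

open scoped Quaternion

noncomputable section

/-- Slice regular functions on the whole of the quaternions: `f` is real differentiable and, for
every imaginary unit `I`, its restriction `(x, y) ↦ f (x + I y)` to the slice `ℝ + ℝ I` is
continuously differentiable and annihilated by `(∂/∂x + I ∂/∂y) / 2`. -/
def IsSliceRegular (f : ℍ[ℝ] → ℍ[ℝ]) : Prop :=
  Differentiable ℝ f ∧
    ∀ I : ℍ[ℝ], I ^ 2 = -1 →
      ContDiff ℝ 1 (fun z : ℝ × ℝ => f ((z.1 : ℍ[ℝ]) + I * (z.2 : ℍ[ℝ]))) ∧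
      ∀ x y : ℝ,
        (1 / 2 : ℝ) •
          (deriv (fun s : ℝ => f ((s : ℍ[ℝ]) + I * (y : ℍ[ℝ]))) x +
            I * deriv (fun t : ℝ => f ((x : ℍ[ℝ]) + I * (t : ℍ[ℝ]))) y) = 0

/-- The quaternionic Segal-Bargmann kernel
`(ν / π) ^ (3/4) * exp (-(ν / 2) (q ^ 2 + x ^ 2) + ν √2 q x)`. -/
def segalBargmannKernel (ν : ℝ) (q : ℍ[ℝ]) (x : ℝ) : ℍ[ℝ] :=
  ((ν / Real.pi) ^ (3 / 4 : ℝ)) •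
    NormedSpace.exp
      (-((ν / 2) • (q ^ 2 + (x : ℍ[ℝ]) ^ 2)) + (ν * Real.sqrt 2) • (q * (x : ℍ[ℝ])))

/-- The quaternionic (slice hyperholomorphic) Segal-Bargmann transform with parameter `ν`;
the kernel multiplies from the left. -/
def segalBargmann (ν : ℝ) (φ : ℝ → ℍ[ℝ]) (q : ℍ[ℝ]) : ℍ[ℝ] :=
  ∫ x : ℝ, segalBargmannKernel ν q x * φ x

/-- The range of the quaternionic Schwartz space on the real line under the Segal-Bargmann
transform with parameter `ν = 1`. -/
def schwartzFock : Set (ℍ[ℝ] → ℍ[ℝ]) :=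
  Set.range (fun ψ : SchwartzMap ℝ ℍ[ℝ] => segalBargmann 1 (fun x => ψ x))

/-- `sup_k |c k| * k ^ p * √(k!) < ∞` for every real `p > 0`. -/
def FactorialDecay (c : ℕ → ℍ[ℝ]) : Prop :=
  ∀ p : ℝ, 0 < p →
    BddAbove (Set.range (fun k : ℕ => ‖c k‖ * (k : ℝ) ^ p * Real.sqrt (k.factorial : ℝ)))

end

/-! The kernel is a generating function: with h_k(x) = He_k(√2 x) exp(-x²/2)/√k! it equals, up to
the constant π^(-3/4), the sum of h_k(x) q^k/√k!. Integrating termwise, the transform of ψ is ∑ q^k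
c_k with √k! c_k = π^(-3/4) ∫ h_k ψ. Since (∗) says that √k! c_k decays rapidly, the theorem
becomes: Schwartz functions correspond to rapidly decaying Hermite coefficients.

From ψ to coefficients, the bound |h_k| ≤ 2(k+1) gives linear growth, and each use of (x + d/dx)/√2
on ψ gains a factor √(k+1) (`hermiteCoeff_lowering`). Conversely, Hermite series with rapidly
decaying coefficients are bounded and stable under x and d/dx, hence Schwartz, and
`RapidDecay.hermiteCoeff_hermiteSum` recovers their coefficients. Power series coefficients are
determined on the real axis, and slice regularity follows from (∗). -/

/-! ### Hermite functions and their ladder relations. -/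

open Polynomial in
theorem derivative_hermite_succ (n : ℕ) :
    derivative (hermite (n + 1)) = ((n : ℤ[X]) + 1) * hermite n := by
  induction n with
  | zero => simp [hermite_succ]
  | succ n ih =>
    rw [hermite_succ (n + 1), derivative_sub, derivative_mul, ih, hermite_succ n]
    simp only [derivative_X, derivative_mul, derivative_add, derivative_natCast,
      derivative_one]
    push_cast
    ring

/-- The Hermite function `He_k(√2 x) exp(-x²/2) / √(k!)`. -/
noncomputable def hermiteFn (k : ℕ) (x : ℝ) : ℝ :=
  Polynomial.aeval (√2 * x) (Polynomial.hermite k) * Real.exp (-x ^ 2 / 2) / √(k.factorial : ℝ)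

theorem hermiteFn_zero (x : ℝ) : hermiteFn 0 x = Real.exp (-x ^ 2 / 2) := by
  simp [hermiteFn]

theorem sqrt_factorial_succ (k : ℕ) :
    √((k + 1).factorial : ℝ) = √((k : ℝ) + 1) * √(k.factorial : ℝ) := by
  rw [Nat.factorial_succ, Nat.cast_mul, Real.sqrt_mul (by positivity)]
  push_cast
  rfl

theorem hasDerivAt_hermiteFn_zero (x : ℝ) :
    HasDerivAt (hermiteFn 0) (-(√2)⁻¹ * hermiteFn 1 x) x := by
  have h : hermiteFn 0 = fun x => Real.exp (-x ^ 2 / 2) := funext hermiteFn_zero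
  rw [h]
  have h2 : √2 * √2 = 2 := Real.mul_self_sqrt (by norm_num)
  have := ((((hasDerivAt_id x).pow 2).neg).div_const 2).exp
  refine this.congr_deriv ?_
  have h0 : √2 ≠ 0 := by positivity
  simp [hermiteFn]
  field_simp

open Polynomial in
theorem hasDerivAt_hermiteFn_succ (k : ℕ) (x : ℝ) :
    HasDerivAt (hermiteFn (k + 1))
      ((√2)⁻¹ * (√((k : ℝ) + 1) * hermiteFn k x - √((k : ℝ) + 2) * hermiteFn (k + 2) x)) x := by
  have h2 : √2 * √2 = 2 := Real.mul_self_sqrt (by norm_num)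
  have hk1 : √((k : ℝ) + 1) * √((k : ℝ) + 1) = k + 1 := Real.mul_self_sqrt (by positivity)
  have hk2 : √((k : ℝ) + 2) ≠ 0 := by positivity
  have h0 : √2 ≠ 0 := by positivity
  have hk0 : √((k : ℝ) + 1) ≠ 0 := by positivity
  have hf0 : √(k.factorial : ℝ) ≠ 0 := by positivity
  have hp := ((hermite (k + 1)).hasDerivAt_aeval (√2 * x)).comp x
    ((hasDerivAt_id x).const_mul √2)
  have he := ((((hasDerivAt_id x).pow 2).neg).div_const 2).exp
  have := (hp.mul he).div_const (√((k + 1).factorial : ℝ))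
  refine this.congr_deriv ?_
  have hs : √(((k + 1 : ℕ) : ℝ) + 1) = √((k : ℝ) + 2) := by
    congr 1; push_cast; ring
  simp only [hermiteFn, sqrt_factorial_succ, hs, hermite_succ (k + 1), derivative_hermite_succ,
    map_sub, map_mul, map_add, map_natCast, map_one, aeval_X, id, Function.comp, Pi.neg_apply,
    Pi.pow_apply]
  field_simp
  simp only [← pow_two] at h2 hk1
  rw [hk1]
  ring_nf
  simp only [h2]
  ring_nf

open Polynomial in
theorem mul_hermiteFn_zero (x : ℝ) : x * hermiteFn 0 x = (√2)⁻¹ * hermiteFn 1 x := by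
  have h0 : √2 ≠ 0 := by positivity
  simp [hermiteFn]
  field_simp

open Polynomial in
theorem mul_hermiteFn_succ (k : ℕ) (x : ℝ) :
    x * hermiteFn (k + 1) x =
      (√2)⁻¹ * (√((k : ℝ) + 1) * hermiteFn k x + √((k : ℝ) + 2) * hermiteFn (k + 2) x) := by
  have h2 : √2 * √2 = 2 := Real.mul_self_sqrt (by norm_num)
  have hk1 : √((k : ℝ) + 1) * √((k : ℝ) + 1) = k + 1 := Real.mul_self_sqrt (by positivity)
  have hk2 : √((k : ℝ) + 2) ≠ 0 := by positivity
  have h0 : √2 ≠ 0 := by positivity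
  have hk0 : √((k : ℝ) + 1) ≠ 0 := by positivity
  have hf0 : √(k.factorial : ℝ) ≠ 0 := by positivity
  have hs : √(((k + 1 : ℕ) : ℝ) + 1) = √((k : ℝ) + 2) := by
    congr 1; push_cast; ring
  simp only [hermiteFn, sqrt_factorial_succ, hs, hermite_succ (k + 1), derivative_hermite_succ,
    map_sub, map_mul, map_add, map_natCast, map_one, aeval_X]
  field_simp
  simp only [← pow_two] at h2 hk1
  rw [hk1]
  ring

/-! ### The generating function over ℂ. -/

open Polynomial in
theorem iteratedDeriv_exp_hermite (y : ℂ) (k : ℕ) :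
    iteratedDeriv k (fun z => Complex.exp (y * z - z ^ 2 / 2)) =
      fun z => aeval (y - z) (hermite k) * Complex.exp (y * z - z ^ 2 / 2) := by
  induction k with
  | zero => simp
  | succ k ih =>
    rw [iteratedDeriv_succ, ih]
    funext z
    have hp := ((hermite k).hasDerivAt_aeval (y - z)).comp z ((hasDerivAt_id z).const_sub y)
    have he := (((hasDerivAt_id z).const_mul y).sub
      (((hasDerivAt_id z).pow 2).div_const 2)).cexp
    refine (hp.mul he).deriv.trans ?_
    simp [hermite_succ]
    ring

theorem differentiable_exp_hermite (y : ℂ) :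
    Differentiable ℂ (fun z => Complex.exp (y * z - z ^ 2 / 2)) := by fun_prop

-- Taylor expansion at 0 of the entire function exp(yz - z²/2) with y = √2 x, multiplied by
-- exp(-x²/2).
open Polynomial in
theorem hasSum_hermiteFn_complex (x : ℝ) (z : ℂ) :
    HasSum (fun k : ℕ => (hermiteFn k x / √(k.factorial : ℝ)) • z ^ k)
      (Complex.exp (-((1 / 2 : ℝ) • (z ^ 2 + (x : ℂ) ^ 2)) + √2 • (z * (x : ℂ)))) := by
  have h := (Complex.hasSum_taylorSeries_of_entire
    (differentiable_exp_hermite ((√2 * x : ℝ) : ℂ)) 0 z).mul_left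
      (Complex.exp ((-x ^ 2 / 2 : ℝ) : ℂ))
  rw [← Complex.exp_add] at h
  convert! h using 1
  · funext k
    have hf : ((√(k.factorial : ℝ) : ℝ) : ℂ) * (√(k.factorial : ℝ) : ℝ) = k.factorial := by
      rw [← Complex.ofReal_mul, Real.mul_self_sqrt (by positivity)]; simp
    have hf0 : ((√(k.factorial : ℝ) : ℝ) : ℂ) ≠ 0 := by
      rw [Complex.ofReal_ne_zero]; positivity
    have ha : aeval ((√2 * x : ℝ) : ℂ) (hermite k) = ((aeval (√2 * x) (hermite k) : ℝ) : ℂ) :=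
      aeval_algebraMap_apply ℂ (√2 * x) (hermite k)
    simp only [iteratedDeriv_exp_hermite, hermiteFn, sub_zero, ha, Complex.real_smul, ← hf,
      smul_eq_mul]
    push_cast
    field_simp
    simp
  · congr 1
    simp only [Complex.real_smul]
    push_cast
    ring

/-! ### A bound on h_k uniform in x. -/

theorem factorial_le_stirling {k : ℕ} (hk : 1 ≤ k) :
    (k.factorial : ℝ) ≤ Real.exp 1 * √k * ((k : ℝ) / Real.exp 1) ^ k := by
  have h1 : Stirling.stirlingSeq k ≤ Stirling.stirlingSeq 1 := by
    obtain ⟨n, rfl⟩ := Nat.exists_eq_add_of_le' hk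
    exact Stirling.stirlingSeq'_antitone (Nat.zero_le n)
  have hk0 : (0 : ℝ) < k := by exact_mod_cast hk
  rw [Stirling.stirlingSeq_one, Stirling.stirlingSeq, div_le_iff₀ (by positivity)] at h1
  refine h1.trans (le_of_eq ?_)
  rw [Real.sqrt_mul (by norm_num)]
  field_simp

-- Cauchy's estimate for the generating function on the circle of radius √k; the Gaussian cancels
-- the growth exp(x²/2). What remains is √k! e^(k/2)/k^(k/2), whose square is at most e√k by
-- Stirling. The final bound is crude, but polynomial growth in k is all that is needed.
open Polynomial in
theorem abs_hermiteFn_le (k : ℕ) (x : ℝ) : |hermiteFn k x| ≤ 2 * ((k : ℝ) + 1) := by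
  rcases Nat.eq_zero_or_pos k with rfl | hk
  · rw [hermiteFn_zero, abs_of_pos (Real.exp_pos _)]
    have : Real.exp (-x ^ 2 / 2) ≤ 1 := Real.exp_le_one_iff.2 (by nlinarith [sq_nonneg x])
    simp; linarith
  have hk0 : (0 : ℝ) < k := by exact_mod_cast hk
  have hsk : (0 : ℝ) < √k := by positivity
  have hC := Complex.norm_iteratedDeriv_le_of_forall_mem_sphere_norm_le (c := 0) (R := √k)
    (C := Real.exp (x ^ 2 / 2 + k / 2)) k hsk
    (differentiable_exp_hermite ((√2 * x : ℝ) : ℂ)).diffContOnCl (by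
      intro z hz
      rw [Complex.norm_exp, Real.exp_le_exp]
      have hz' : z.re * z.re + z.im * z.im = k := by
        rw [mem_sphere_zero_iff_norm] at hz
        rw [← Complex.normSq_apply, Complex.normSq_eq_norm_sq, hz, Real.sq_sqrt hk0.le]
      have h2 : √2 * √2 = 2 := Real.mul_self_sqrt (by norm_num)
      have : (((√2 * x : ℝ) : ℂ) * z - z ^ 2 / 2).re =
          √2 * x * z.re - (z.re * z.re - z.im * z.im) / 2 := by
        rw [Complex.sub_re, Complex.re_ofReal_mul, pow_two]
        simp [Complex.mul_re]
      rw [this]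
      -- With |z|² = k the real part is √2 x Re z - (Re z)² + k/2; complete the square.
      nlinarith [sq_nonneg (x - √2 * z.re)])
  have ha : aeval ((√2 * x : ℝ) : ℂ) (hermite k) = ((aeval (√2 * x) (hermite k) : ℝ) : ℂ) :=
    aeval_algebraMap_apply ℂ (√2 * x) (hermite k)
  simp only [iteratedDeriv_exp_hermite, sub_zero, ha] at hC
  simp only [mul_zero, ne_eq, OfNat.ofNat_ne_zero, not_false_eq_true, zero_pow, zero_div, sub_zero,
    Complex.exp_zero, mul_one, Complex.norm_real, Real.norm_eq_abs] at hC
  have hf : (0 : ℝ) < √(k.factorial : ℝ) := by positivity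
  have hff : √(k.factorial : ℝ) * √(k.factorial : ℝ) = k.factorial :=
    Real.mul_self_sqrt (by positivity)
  have hbound : |hermiteFn k x| ≤ √(k.factorial : ℝ) * Real.exp (k / 2) / √k ^ k := by
    rw [hermiteFn, abs_div, abs_mul, abs_of_pos hf, abs_of_pos (Real.exp_pos _),
      div_le_iff₀ hf]
    calc _ ≤ (k.factorial * Real.exp (x ^ 2 / 2 + k / 2) / √k ^ k) * Real.exp (-x ^ 2 / 2) := by
          gcongr
      _ = √(k.factorial : ℝ) * √(k.factorial : ℝ) *
          (Real.exp (x ^ 2 / 2 + k / 2) * Real.exp (-x ^ 2 / 2)) / √k ^ k := by rw [hff]; ring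
      _ = _ := by
          rw [← Real.exp_add]
          ring_nf
  refine hbound.trans (abs_le_of_sq_le_sq' ?_ (by positivity)).2
  have he : Real.exp (k / 2) ^ 2 = Real.exp 1 ^ k := by
    rw [← Real.exp_nat_mul, ← Real.exp_nat_mul]
    congr 1; push_cast; ring
  have hkk : (√k ^ k) ^ 2 = (k : ℝ) ^ k := by
    rw [← pow_mul, mul_comm, pow_mul, Real.sq_sqrt hk0.le]
  rw [div_pow, mul_pow, he, hkk, Real.sq_sqrt (by positivity)]
  have hst := factorial_le_stirling hk
  rw [div_pow] at hst
  calc _ ≤ (Real.exp 1 * √k * ((k : ℝ) ^ k / Real.exp 1 ^ k)) * Real.exp 1 ^ k / (k : ℝ) ^ k := by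
        gcongr
    _ = Real.exp 1 * √k := by field_simp
    _ ≤ 3 * (k + 1) := by
        have := Real.exp_one_lt_d9
        have : √(k : ℝ) ≤ k + 1 := by
          rw [Real.sqrt_le_left (by positivity)]; nlinarith
        gcongr
        linarith
    _ ≤ _ := by nlinarith

/-! ### The generating function over the quaternions. -/

theorem exists_imaginary_unit_eq_add (q : ℍ[ℝ]) :
    ∃ I : ℍ[ℝ], I * I = -1 ∧ ∃ a b : ℝ, q = (a : ℍ[ℝ]) + b • I := by
  by_cases h : q.im = 0
  -- A real q lies in every slice, so any imaginary unit serves.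
  · refine ⟨((Complex.I : ℂ) : ℍ[ℝ]), ?_, q.re, 0, ?_⟩
    · rw [← Quaternion.coeComplex_mul, Complex.I_mul_I]
      ext <;> simp
    · nth_rw 1 [← Quaternion.re_add_im q]
      simp [h]
  · have hn : ‖q.im‖ ≠ 0 := norm_ne_zero_iff.2 h
    refine ⟨‖q.im‖⁻¹ • q.im, ?_, q.re, ‖q.im‖, ?_⟩
    · have h1 : q.im ^ 2 = -((Quaternion.normSq q.im : ℝ) : ℍ[ℝ]) :=
        Quaternion.sq_eq_neg_normSq.2 (Quaternion.re_im q)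
      rw [smul_mul_smul_comm, ← pow_two q.im, h1, Quaternion.normSq_eq_norm_mul_self, smul_neg,
        Quaternion.smul_coe]
      have : ‖q.im‖⁻¹ * ‖q.im‖⁻¹ * (‖q.im‖ * ‖q.im‖) = 1 := by field_simp
      rw [this, Quaternion.coe_one]
    · rw [smul_smul, mul_inv_cancel₀ hn, one_smul, Quaternion.re_add_im]

/-- Every q lies in the image of ℂ under a continuous real algebra map i ↦ I, which carries the
complex identity over because its coefficients are real. -/
theorem hasSum_hermiteFn_quaternion (x : ℝ) (q : ℍ[ℝ]) :
    HasSum (fun k : ℕ => (hermiteFn k x / √(k.factorial : ℝ)) • q ^ k)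
      (NormedSpace.exp (-((1 / 2 : ℝ) • (q ^ 2 + (x : ℍ[ℝ]) ^ 2)) + √2 • (q * (x : ℍ[ℝ])))) := by
  obtain ⟨I, hI, a, b, rfl⟩ := exists_imaginary_unit_eq_add q
  let φ : ℂ →ₐ[ℝ] ℍ[ℝ] := Complex.liftAux I hI
  have hφ : Continuous φ := φ.toLinearMap.continuous_of_finiteDimensional
  have hreal (t : ℝ) : φ (t : ℂ) = (t : ℍ[ℝ]) := φ.commutes t
  have hz : φ ⟨a, b⟩ = (a : ℍ[ℝ]) + b • I := Complex.liftAux_apply I hI ⟨a, b⟩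
  have h := (hasSum_hermiteFn_complex x ⟨a, b⟩).map φ hφ
  rw [Complex.exp_eq_exp_ℂ, NormedSpace.map_exp φ hφ] at h
  simp only [Function.comp_def, map_smul, map_pow, map_add, map_neg, map_mul, hz, hreal] at h
  exact h

/-! ### Hermite coefficients of Schwartz functions decay rapidly. -/

open MeasureTheory

/-- At k = 0 the truncated index k - 1 is harmless: its factor √k vanishes. -/
theorem mul_hermiteFn (k : ℕ) (x : ℝ) :
    x * hermiteFn k x =
      (√2)⁻¹ * (√(k : ℝ) * hermiteFn (k - 1) x + √((k : ℝ) + 1) * hermiteFn (k + 1) x) := by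
  rcases k with _ | k
  · simpa using mul_hermiteFn_zero x
  · have : ((k + 1 : ℕ) : ℝ) + 1 = k + 2 := by push_cast; ring
    rw [this, mul_hermiteFn_succ]
    push_cast
    rfl

theorem hasDerivAt_hermiteFn (k : ℕ) (x : ℝ) :
    HasDerivAt (hermiteFn k)
      ((√2)⁻¹ * (√(k : ℝ) * hermiteFn (k - 1) x - √((k : ℝ) + 1) * hermiteFn (k + 1) x)) x := by
  rcases k with _ | k
  · simpa using hasDerivAt_hermiteFn_zero x
  · have : ((k + 1 : ℕ) : ℝ) + 1 = k + 2 := by push_cast; ring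
    rw [this]
    push_cast
    exact hasDerivAt_hermiteFn_succ k x

theorem continuous_hermiteFn (k : ℕ) : Continuous (hermiteFn k) :=
  continuous_iff_continuousAt.2 fun x => (hasDerivAt_hermiteFn k x).continuousAt

section Coefficients

variable {E : Type*} [NormedAddCommGroup E] [NormedSpace ℝ E]

theorem integrable_hermiteFn_smul (k : ℕ) {f : ℝ → E} (hf : Integrable f) :
    Integrable (fun x => hermiteFn k x • f x) :=
  hf.bdd_smul (2 * ((k : ℝ) + 1)) (continuous_hermiteFn k).aestronglyMeasurable
    (.of_forall fun x => abs_hermiteFn_le k x)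

/-- The Hermite coefficients of a vector-valued function on the line. -/
noncomputable def hermiteCoeff (k : ℕ) (f : ℝ → E) : E := ∫ x, hermiteFn k x • f x

theorem norm_hermiteCoeff_le (k : ℕ) {f : ℝ → E} (hf : Integrable f) :
    ‖hermiteCoeff k f‖ ≤ 2 * ((k : ℝ) + 1) * ∫ x, ‖f x‖ := by
  rw [← integral_const_mul]
  refine norm_integral_le_of_norm_le (hf.norm.const_mul _) (.of_forall fun x => ?_)
  rw [norm_smul]
  gcongr
  exact abs_hermiteFn_le k x

theorem hermiteCoeff_add (k : ℕ) {f g : ℝ → E} (hf : Integrable f) (hg : Integrable g) :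
    hermiteCoeff k (fun x => f x + g x) = hermiteCoeff k f + hermiteCoeff k g := by
  simp only [hermiteCoeff, smul_add]
  exact integral_add (integrable_hermiteFn_smul k hf) (integrable_hermiteFn_smul k hg)

theorem hermiteCoeff_smul (k : ℕ) (r : ℝ) (f : ℝ → E) :
    hermiteCoeff k (fun x => r • f x) = r • hermiteCoeff k f := by
  simp only [hermiteCoeff, smul_comm _ r]
  exact integral_smul r _

theorem hermiteCoeff_id_smul (k : ℕ) {f : ℝ → E} (hf : Integrable f) :
    hermiteCoeff k (fun x => x • f x) =
      (√2)⁻¹ • (√(k : ℝ) • hermiteCoeff (k - 1) f + √((k : ℝ) + 1) • hermiteCoeff (k + 1) f) := by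
  simp only [hermiteCoeff, ← integral_smul]
  have h1 : Integrable (fun x => √(k : ℝ) • hermiteFn (k - 1) x • f x) :=
    (integrable_hermiteFn_smul (k - 1) hf).smul _
  have h2 : Integrable (fun x => √((k : ℝ) + 1) • hermiteFn (k + 1) x • f x) :=
    (integrable_hermiteFn_smul (k + 1) hf).smul _
  rw [← integral_add h1 h2, ← integral_smul]
  refine integral_congr_ae (.of_forall fun x => ?_)
  simp only [smul_smul, ← add_smul]
  rw [mul_comm, mul_hermiteFn]

theorem hermiteCoeff_hasDerivAt (k : ℕ) {f f' : ℝ → E} (h : ∀ x, HasDerivAt f (f' x) x)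
    (hf : Integrable f) (hf' : Integrable f') :
    hermiteCoeff k f' =
      (√2)⁻¹ • (√((k : ℝ) + 1) • hermiteCoeff (k + 1) f - √(k : ℝ) • hermiteCoeff (k - 1) f) := by
  have hi : (fun x => ((√2)⁻¹ * (√(k : ℝ) * hermiteFn (k - 1) x -
      √((k : ℝ) + 1) * hermiteFn (k + 1) x)) • f x) = fun x =>
      (√2)⁻¹ • (√(k : ℝ) • hermiteFn (k - 1) x • f x -
        √((k : ℝ) + 1) • hermiteFn (k + 1) x • f x) := by
    funext x
    simp only [smul_smul, ← sub_smul]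
  have h1 : Integrable (fun x => √(k : ℝ) • hermiteFn (k - 1) x • f x) :=
    (integrable_hermiteFn_smul (k - 1) hf).smul _
  have h2 : Integrable (fun x => √((k : ℝ) + 1) • hermiteFn (k + 1) x • f x) :=
    (integrable_hermiteFn_smul (k + 1) hf).smul _
  have := integral_bilinear_hasDerivAt_right_eq_neg_left_of_integrable
    (L := ContinuousLinearMap.lsmul ℝ ℝ (E := E)) (fun x _ => hasDerivAt_hermiteFn k x)
    (fun x _ => h x) (integrable_hermiteFn_smul k hf')
    (by
      simp only [ContinuousLinearMap.lsmul_apply, hi]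
      exact (h1.sub h2).smul (√2)⁻¹)
    (integrable_hermiteFn_smul k hf)
  simp only [ContinuousLinearMap.lsmul_apply, hi] at this
  rw [hermiteCoeff, this, integral_smul, integral_sub h1 h2, integral_smul, integral_smul,
    ← smul_neg, neg_sub]
  rfl

/-- `(x + d/dx) / √2` -/
noncomputable def lowering (ψ : SchwartzMap ℝ E) : SchwartzMap ℝ E :=
  (√2)⁻¹ • (SchwartzMap.smulLeftCLM E (fun x : ℝ => x) ψ + SchwartzMap.derivCLM ℝ E ψ)

/-- Integration by parts moves the operator onto h_k as (x - d/dx)/√2, which sends h_k to √(k+1)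
h_{k+1}; the h_{k-1} terms cancel. -/
theorem hermiteCoeff_lowering (k : ℕ) (ψ : SchwartzMap ℝ E) :
    hermiteCoeff k (lowering ψ) = √((k : ℝ) + 1) • hermiteCoeff (k + 1) ψ := by
  have h0 : √2 ≠ 0 := by positivity
  have h2 : √2 * √2 = 2 := Real.mul_self_sqrt (by norm_num)
  have hx : (SchwartzMap.smulLeftCLM E (fun x : ℝ => x) ψ : ℝ → E) = fun x => x • ψ x :=
    SchwartzMap.smulLeftCLM_apply (by fun_prop) ψ
  have hd (x : ℝ) : HasDerivAt ψ (SchwartzMap.derivCLM ℝ E ψ x) x := by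
    rw [SchwartzMap.derivCLM_apply]
    exact ψ.differentiableAt.hasDerivAt
  change hermiteCoeff k (fun x => (√2)⁻¹ • (SchwartzMap.smulLeftCLM E (fun x : ℝ => x) ψ x +
    SchwartzMap.derivCLM ℝ E ψ x)) = _
  rw [hermiteCoeff_smul, hermiteCoeff_add k (SchwartzMap.integrable _) (SchwartzMap.integrable _),
    hx, hermiteCoeff_id_smul k ψ.integrable,
    hermiteCoeff_hasDerivAt k hd ψ.integrable (SchwartzMap.integrable _), ← smul_add, smul_smul]
  have : (√2)⁻¹ * (√2)⁻¹ = 2⁻¹ := by rw [← mul_inv, h2]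
  rw [this]
  module

/-- Sequences decaying faster than every power. -/
def RapidDecay (b : ℕ → E) : Prop :=
  ∀ p : ℕ, ∃ C : ℝ, ∀ k : ℕ, ((k : ℝ) + 1) ^ p * ‖b k‖ ≤ C

theorem sqrt_pow_mul_norm_hermiteCoeff_le (p : ℕ) (ψ : SchwartzMap ℝ E) :
    ∃ C : ℝ, ∀ k : ℕ, √((k : ℝ) + 1) ^ p * ‖hermiteCoeff k ψ‖ ≤ C * ((k : ℝ) + 1) := by
  induction p generalizing ψ with
  | zero =>
    refine ⟨2 * ∫ x, ‖ψ x‖, fun k => ?_⟩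
    rw [pow_zero, one_mul]
    linarith [norm_hermiteCoeff_le k ψ.integrable]
  | succ p ih =>
    obtain ⟨C, hC⟩ := ih (lowering ψ)
    have hC0 : 0 ≤ C := by
      have := (by positivity : 0 ≤ √(((0 : ℕ) : ℝ) + 1) ^ p * ‖hermiteCoeff 0 (lowering ψ)‖).trans
        (hC 0)
      simpa using this
    -- Lowering reaches only indices k + 1, so index 0 is added by hand; the power of 2 pays for
    -- √(k+2) ≤ 2√(k+1).
    refine ⟨2 ^ (p + 1) * C + ‖hermiteCoeff 0 ψ‖, fun k => ?_⟩
    rcases k with _ | k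
    · have : 0 ≤ 2 ^ (p + 1) * C := by positivity
      simp
      linarith
    have hs : √(((k + 1 : ℕ) : ℝ) + 1) ≤ 2 * √((k : ℝ) + 1) := by
      rw [Real.sqrt_le_left (by positivity), mul_pow, Real.sq_sqrt (by positivity)]
      push_cast
      linarith [(Nat.cast_nonneg k : (0 : ℝ) ≤ k)]
    have hk := hC k
    rw [hermiteCoeff_lowering, norm_smul, Real.norm_of_nonneg (by positivity)] at hk
    calc _ ≤ (2 * √((k : ℝ) + 1)) ^ (p + 1) * ‖hermiteCoeff (k + 1) ψ‖ := by gcongr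
      _ = 2 ^ (p + 1) * (√((k : ℝ) + 1) ^ p * (√((k : ℝ) + 1) * ‖hermiteCoeff (k + 1) ψ‖)) := by
          ring
      _ ≤ 2 ^ (p + 1) * (C * (k + 1)) := by gcongr
      _ ≤ (2 ^ (p + 1) * C + ‖hermiteCoeff 0 ψ‖) * (((k + 1 : ℕ) : ℝ) + 1) := by
          push_cast
          rw [← mul_assoc]
          gcongr
          · linarith [norm_nonneg (hermiteCoeff 0 ψ)]
          · linarith

theorem rapidDecay_hermiteCoeff (ψ : SchwartzMap ℝ E) :
    RapidDecay (fun k => hermiteCoeff k ψ) := by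
  intro p
  -- The extra factor k + 1 absorbs the linear growth on the right.
  obtain ⟨C, hC⟩ := sqrt_pow_mul_norm_hermiteCoeff_le (2 * (p + 1)) ψ
  refine ⟨C, fun k => ?_⟩
  have h := hC k
  rw [pow_mul, Real.sq_sqrt (by positivity), pow_succ] at h
  have hk : (0 : ℝ) < k + 1 := by positivity
  refine le_of_mul_le_mul_right ?_ hk
  linarith

end Coefficients

/-! ### Factorial decay and convergence of the power series. -/

theorem factorialDecay_iff_rapidDecay (c : ℕ → ℍ[ℝ]) :
    FactorialDecay c ↔ RapidDecay (fun k => √(k.factorial : ℝ) • c k) := by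
  constructor
  · intro h p
    obtain ⟨M, hM⟩ := h (p + 1) (by positivity)
    have hM' (k : ℕ) : ‖c k‖ * (k : ℝ) ^ (p + 1) * √(k.factorial : ℝ) ≤ M := by
      have := hM ⟨k, rfl⟩
      simp only at this
      exact_mod_cast this
    have hM0 : 0 ≤ M := le_trans (by positivity) (hM' 0)
    -- For p > 0 the weight k^p vanishes at k = 0, so (∗) does not bound c 0.
    refine ⟨2 ^ p * M + ‖c 0‖, fun k => ?_⟩
    rw [norm_smul, Real.norm_of_nonneg (by positivity)]
    rcases k with _ | k
    · have : 0 ≤ 2 ^ p * M := by positivity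
      simp
      linarith
    have h1 : ((k + 1 : ℕ) : ℝ) + 1 ≤ 2 * (k + 1 : ℕ) := by
      push_cast; linarith [(Nat.cast_nonneg k : (0 : ℝ) ≤ k)]
    have h2 : ((k + 1 : ℕ) : ℝ) ^ p ≤ ((k + 1 : ℕ) : ℝ) ^ (p + 1) :=
      pow_le_pow_right₀ (by push_cast; linarith [(Nat.cast_nonneg k : (0 : ℝ) ≤ k)]) (by simp)
    calc _ ≤ (2 * ((k + 1 : ℕ) : ℝ)) ^ p * (√((k + 1).factorial : ℝ) * ‖c (k + 1)‖) := by gcongr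
      _ = 2 ^ p * (‖c (k + 1)‖ * ((k + 1 : ℕ) : ℝ) ^ p * √((k + 1).factorial : ℝ)) := by ring
      _ ≤ 2 ^ p * (‖c (k + 1)‖ * ((k + 1 : ℕ) : ℝ) ^ (p + 1) * √((k + 1).factorial : ℝ)) := by
          gcongr
      _ ≤ 2 ^ p * M := by gcongr; exact hM' _
      _ ≤ _ := by linarith [norm_nonneg (c 0)]
  · intro h p hp
    obtain ⟨C, hC⟩ := h ⌈p⌉₊
    refine ⟨C, ?_⟩
    rintro _ ⟨k, rfl⟩
    refine le_trans ?_ (hC k)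
    rw [norm_smul, Real.norm_of_nonneg (by positivity)]
    have : (k : ℝ) ^ p ≤ ((k : ℝ) + 1) ^ ⌈p⌉₊ := by
      rw [← Real.rpow_natCast]
      calc (k : ℝ) ^ p ≤ ((k : ℝ) + 1) ^ p := by gcongr; linarith
        _ ≤ _ := Real.rpow_le_rpow_of_exponent_le (by simp) (Nat.le_ceil p)
    calc _ = (k : ℝ) ^ p * (√(k.factorial : ℝ) * ‖c k‖) := by ring
      _ ≤ _ := by gcongr

/-- Since k + 1 ≤ 2^k, the term is at most a = (2r)^k/√k!, and AM-GM gives a ≤ 2^k a² + 2^(-k), an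
exponential series plus a geometric one. -/
theorem summable_pow_div_sqrt_factorial {r : ℝ} (hr : 0 ≤ r) :
    Summable (fun k : ℕ => ((k : ℝ) + 1) * (r ^ k / √(k.factorial : ℝ))) := by
  have h1 : Summable (fun k : ℕ => (8 * r ^ 2) ^ k / (k.factorial : ℝ)) :=
    Real.summable_pow_div_factorial _
  have h2 : Summable (fun k : ℕ => (1 / 2 : ℝ) ^ k) := summable_geometric_two
  refine Summable.of_nonneg_of_le (fun k => by positivity) (fun k => ?_) (h1.add h2)
  have hk : (k : ℝ) + 1 ≤ 2 ^ k := by exact_mod_cast Nat.lt_two_pow_self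
  have hf : (0 : ℝ) < √(k.factorial : ℝ) := by positivity
  have hsq : √(k.factorial : ℝ) ^ 2 = k.factorial := Real.sq_sqrt (by positivity)
  have h0 : 0 ≤ r ^ k / √(k.factorial : ℝ) := by positivity
  set a := 2 ^ k * (r ^ k / √(k.factorial : ℝ)) with ha
  have hA : (8 * r ^ 2) ^ k / (k.factorial : ℝ) = 2 ^ k * a ^ 2 := by
    have h8 : (8 : ℝ) ^ k = 2 ^ k * (2 ^ k) ^ 2 := by
      rw [show (8 : ℝ) = 2 * 2 ^ 2 by norm_num, mul_pow, ← pow_mul, ← pow_mul, mul_comm k 2]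
    rw [ha, mul_pow, mul_pow, div_pow, hsq, h8]
    ring
  have hB : (2 : ℝ) ^ k * (1 / 2) ^ k = 1 := by rw [← mul_pow]; norm_num
  rw [hA]
  have hle : ((k : ℝ) + 1) * (r ^ k / √(k.factorial : ℝ)) ≤ a := by
    rw [ha]; gcongr
  refine hle.trans ?_
  have h3 : (0 : ℝ) < (1 / 2) ^ k := by positivity
  have h4 : (0 : ℝ) < 2 ^ k := by positivity
  nlinarith [mul_nonneg h4.le (sq_nonneg (a - (1 / 2) ^ k)), sq_nonneg a, mul_pos h4 h3]

theorem FactorialDecay.summable_norm_mul_pow {c : ℕ → ℍ[ℝ]} (h : FactorialDecay c) {r : ℝ}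
    (hr : 0 ≤ r) : Summable (fun k : ℕ => ((k : ℝ) + 1) * (‖c k‖ * r ^ k)) := by
  obtain ⟨C, hC⟩ := (factorialDecay_iff_rapidDecay c).1 h 0
  refine Summable.of_nonneg_of_le (fun k => by positivity) (fun k => ?_)
    ((summable_pow_div_sqrt_factorial hr).mul_left C)
  have hk := hC k
  have hf : (0 : ℝ) < √(k.factorial : ℝ) := by positivity
  rw [norm_smul, Real.norm_of_nonneg hf.le, pow_zero, one_mul] at hk
  have : ‖c k‖ ≤ C / √(k.factorial : ℝ) := by
    rw [le_div_iff₀ hf]; linarith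
  calc _ ≤ ((k : ℝ) + 1) * (C / √(k.factorial : ℝ) * r ^ k) := by gcongr
    _ = _ := by ring

/-! ### Power series of the transform. -/

/-- The uniform bound on h_k makes the integrals of norms summable, so the generating series may be
integrated termwise. -/
theorem hasSum_segalBargmann (ψ : SchwartzMap ℝ ℍ[ℝ]) (q : ℍ[ℝ]) :
    HasSum (fun k : ℕ => q ^ k *
      (((1 / Real.pi) ^ (3 / 4 : ℝ) / √(k.factorial : ℝ)) • hermiteCoeff k ψ))
      (segalBargmann 1 (fun x => ψ x) q) := by
  set κ : ℝ := (1 / Real.pi) ^ (3 / 4 : ℝ) with hκ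
  have hκ0 : 0 ≤ κ := by positivity
  have hi (k : ℕ) : Integrable (fun x => (κ / √(k.factorial : ℝ)) •
      (q ^ k * (hermiteFn k x • ψ x))) :=
    ((integrable_hermiteFn_smul k ψ.integrable).const_mul (q ^ k)).smul
      (κ / √(k.factorial : ℝ))
  have hs : Summable (fun k : ℕ => ∫ x, ‖(κ / √(k.factorial : ℝ)) •
      (q ^ k * (hermiteFn k x • ψ x))‖) := by
    refine Summable.of_nonneg_of_le (fun k => integral_nonneg fun x => norm_nonneg _) (fun k => ?_)
      ((summable_pow_div_sqrt_factorial (norm_nonneg q)).mul_left (κ * 2 * ∫ x, ‖ψ x‖))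
    calc _ ≤ ∫ x, (κ / √(k.factorial : ℝ) * (‖q‖ ^ k * (2 * ((k : ℝ) + 1)))) * ‖ψ x‖ := by
          refine integral_mono (hi k).norm (ψ.integrable.norm.const_mul _) fun x => ?_
          simp only [norm_smul, norm_mul, norm_pow]
          rw [Real.norm_of_nonneg (by positivity), mul_assoc, mul_assoc]
          gcongr
          exact abs_hermiteFn_le k x
      _ = _ := by
          rw [integral_const_mul]
          ring
  have h := hasSum_integral_of_summable_integral_norm hi hs
  convert! h using 1
  · funext k
    rw [integral_smul, integral_const_mul_of_integrable (integrable_hermiteFn_smul k ψ.integrable),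
      mul_smul_comm]
    rfl
  · rw [segalBargmann]
    refine integral_congr_ae (.of_forall fun x => ?_)
    have hx := ((hasSum_hermiteFn_quaternion x q).mul_right (ψ x)).const_smul κ
    refine Eq.trans ?_ (hx.congr_fun ?_).tsum_eq.symm
    · simp only [segalBargmannKernel, one_mul, smul_mul_assoc, ← hκ]
    · intro k
      simp only [mul_smul_comm, smul_mul_assoc, smul_smul]
      congr 1
      ring

/-! ### Hermite series with rapidly decaying coefficients are Schwartz. -/

section HermiteSeries

variable {E : Type*} [NormedAddCommGroup E]

theorem RapidDecay.add {a b : ℕ → E} (ha : RapidDecay a) (hb : RapidDecay b) :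
    RapidDecay (fun k => a k + b k) := by
  intro p
  obtain ⟨C, hC⟩ := ha p
  obtain ⟨D, hD⟩ := hb p
  refine ⟨C + D, fun k => ?_⟩
  calc _ ≤ ((k : ℝ) + 1) ^ p * (‖a k‖ + ‖b k‖) := by gcongr; exact norm_add_le _ _
    _ ≤ _ := by rw [mul_add]; exact add_le_add (hC k) (hD k)

theorem RapidDecay.summable {b : ℕ → E} (hb : RapidDecay b) (p : ℕ) :
    Summable (fun k : ℕ => ((k : ℝ) + 1) ^ p * ‖b k‖) := by
  obtain ⟨C, hC⟩ := hb (p + 2)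
  have h1 : Summable (fun k : ℕ => C * (1 / (((k + 1 : ℕ) : ℝ)) ^ 2)) :=
    ((summable_nat_add_iff 1).2 (Real.summable_one_div_nat_pow.2 one_lt_two)).mul_left C
  refine Summable.of_nonneg_of_le (fun k => by positivity) (fun k => ?_) h1
  rw [mul_one_div, le_div_iff₀ (by positivity)]
  refine le_trans (le_of_eq ?_) (hC k)
  push_cast
  ring

variable [NormedSpace ℝ E]

theorem RapidDecay.const_smul (r : ℝ) {b : ℕ → E} (hb : RapidDecay b) :
    RapidDecay (fun k => r • b k) := by
  intro p
  obtain ⟨D, hD⟩ := hb p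
  refine ⟨‖r‖ * D, fun k => ?_⟩
  rw [norm_smul, mul_left_comm]
  gcongr
  exact hD k

theorem RapidDecay.sub {a b : ℕ → E} (ha : RapidDecay a) (hb : RapidDecay b) :
    RapidDecay (fun k => a k - b k) := by
  simpa [sub_eq_add_neg] using ha.add (hb.const_smul (-1))

theorem sqrt_natCast_add_one_le (k : ℕ) : √((k : ℝ) + 1) ≤ k + 1 := by
  rw [Real.sqrt_le_left (by positivity)]
  nlinarith [(Nat.cast_nonneg k : (0 : ℝ) ≤ k)]

/-- The action of `(x + d/dx) / √2` on Hermite coefficients. -/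
noncomputable def lowerSeq (b : ℕ → E) (k : ℕ) : E := √((k : ℝ) + 1) • b (k + 1)

/-- The action of `(x - d/dx) / √2` on Hermite coefficients. -/
noncomputable def raiseSeq (b : ℕ → E) (k : ℕ) : E := √(k : ℝ) • b (k - 1)

theorem RapidDecay.lowerSeq {b : ℕ → E} (hb : RapidDecay b) : RapidDecay (lowerSeq b) := by
  intro p
  obtain ⟨D, hD⟩ := hb (p + 1)
  refine ⟨D, fun k => le_trans ?_ (hD (k + 1))⟩
  rw [_root_.lowerSeq, norm_smul, Real.norm_of_nonneg (by positivity), ← mul_assoc, pow_succ]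
  have := sqrt_natCast_add_one_le k
  push_cast
  gcongr <;> linarith

theorem RapidDecay.raiseSeq {b : ℕ → E} (hb : RapidDecay b) : RapidDecay (raiseSeq b) := by
  intro p
  obtain ⟨D, hD⟩ := hb (p + 1)
  have hD0 : 0 ≤ D := le_trans (by positivity) (hD 0)
  refine ⟨2 ^ p * D, fun k => ?_⟩
  rcases k with _ | k
  · simp only [_root_.raiseSeq, Nat.cast_zero, Real.sqrt_zero, zero_smul, norm_zero, mul_zero]
    positivity
  rw [_root_.raiseSeq, norm_smul, Real.norm_of_nonneg (by positivity)]
  have := sqrt_natCast_add_one_le k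
  have h2 : (k : ℝ) + 1 + 1 ≤ 2 * (k + 1) := by linarith [(Nat.cast_nonneg k : (0 : ℝ) ≤ k)]
  push_cast
  calc _ ≤ (2 * ((k : ℝ) + 1)) ^ p * (((k : ℝ) + 1) * ‖b k‖) := by gcongr
    _ = 2 ^ p * (((k : ℝ) + 1) ^ (p + 1) * ‖b k‖) := by rw [mul_pow]; ring
    _ ≤ _ := by gcongr; exact hD k

/-- The Hermite series with coefficients `b`. -/
noncomputable def hermiteSum (b : ℕ → E) (x : ℝ) : E := ∑' k, hermiteFn k x • b k

theorem norm_hermiteFn_smul_le (b : ℕ → E) (x : ℝ) (k : ℕ) :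
    ‖hermiteFn k x • b k‖ ≤ 2 * (((k : ℝ) + 1) ^ 1 * ‖b k‖) := by
  rw [norm_smul, pow_one, ← mul_assoc]
  gcongr
  exact abs_hermiteFn_le k x

/-- The action of `x` on Hermite coefficients. -/
noncomputable def mulSeq (b : ℕ → E) (k : ℕ) : E := (√2)⁻¹ • (lowerSeq b k + raiseSeq b k)

/-- The action of `d/dx` on Hermite coefficients. -/
noncomputable def derivSeq (b : ℕ → E) (k : ℕ) : E := (√2)⁻¹ • (lowerSeq b k - raiseSeq b k)

theorem RapidDecay.mulSeq {b : ℕ → E} (hb : RapidDecay b) : RapidDecay (mulSeq b) :=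
  (hb.lowerSeq.add hb.raiseSeq).const_smul _

theorem RapidDecay.derivSeq {b : ℕ → E} (hb : RapidDecay b) : RapidDecay (derivSeq b) :=
  (hb.lowerSeq.sub hb.raiseSeq).const_smul _

theorem RapidDecay.exists_norm_hermiteSum_le {b : ℕ → E} (hb : RapidDecay b) :
    ∃ C, ∀ x, ‖hermiteSum b x‖ ≤ C :=
  ⟨_, fun x => tsum_of_norm_bounded ((hb.summable 1).mul_left 2).hasSum
    (norm_hermiteFn_smul_le b x)⟩

variable [CompleteSpace E]

theorem RapidDecay.hasSum_hermiteFn {b : ℕ → E} (hb : RapidDecay b) (x : ℝ) :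
    HasSum (fun k => hermiteFn k x • b k) (hermiteSum b x) :=
  (Summable.of_norm_bounded ((hb.summable 1).mul_left 2) (norm_hermiteFn_smul_le b x)).hasSum

theorem RapidDecay.hasSum_lowerSeq {b : ℕ → E} (hb : RapidDecay b) (x : ℝ) :
    HasSum (fun k : ℕ => (√(k : ℝ) * hermiteFn (k - 1) x) • b k)
      (hermiteSum (_root_.lowerSeq b) x) := by
  rw [← hasSum_nat_add_iff' 1]
  simp only [Finset.range_one, Finset.sum_singleton, Nat.cast_zero, Real.sqrt_zero, zero_mul,
    zero_smul, sub_zero]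
  convert! hb.lowerSeq.hasSum_hermiteFn x using 2 with k
  rw [_root_.lowerSeq, smul_smul, mul_comm]
  simp

theorem RapidDecay.hasSum_raiseSeq {b : ℕ → E} (hb : RapidDecay b) (x : ℝ) :
    HasSum (fun k : ℕ => (√((k : ℝ) + 1) * hermiteFn (k + 1) x) • b k)
      (hermiteSum (_root_.raiseSeq b) x) := by
  have h := (hasSum_nat_add_iff' 1).2 (hb.raiseSeq.hasSum_hermiteFn x)
  simp only [Finset.range_one, Finset.sum_singleton, _root_.raiseSeq, Nat.cast_zero,
    Real.sqrt_zero, zero_smul, smul_zero, sub_zero] at h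
  convert! h using 2 with k
  rw [smul_smul, mul_comm]
  simp

theorem RapidDecay.hermiteSum_mulSeq_eq {b : ℕ → E} (hb : RapidDecay b) (x : ℝ) :
    hermiteSum (_root_.mulSeq b) x =
      (√2)⁻¹ • (hermiteSum (_root_.lowerSeq b) x + hermiteSum (_root_.raiseSeq b) x) := by
  refine (hb.mulSeq.hasSum_hermiteFn x).unique ?_
  convert! ((hb.lowerSeq.hasSum_hermiteFn x).add
    (hb.raiseSeq.hasSum_hermiteFn x)).const_smul (√2)⁻¹ using 2 with k
  rw [_root_.mulSeq, smul_comm, smul_add]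

theorem RapidDecay.hermiteSum_derivSeq_eq {b : ℕ → E} (hb : RapidDecay b) (x : ℝ) :
    hermiteSum (_root_.derivSeq b) x =
      (√2)⁻¹ • (hermiteSum (_root_.lowerSeq b) x - hermiteSum (_root_.raiseSeq b) x) := by
  refine (hb.derivSeq.hasSum_hermiteFn x).unique ?_
  convert! ((hb.lowerSeq.hasSum_hermiteFn x).sub
    (hb.raiseSeq.hasSum_hermiteFn x)).const_smul (√2)⁻¹ using 2 with k
  rw [_root_.derivSeq, smul_comm, smul_sub]

theorem RapidDecay.smul_hermiteSum {b : ℕ → E} (hb : RapidDecay b) (x : ℝ) :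
    x • hermiteSum b x = hermiteSum (_root_.mulSeq b) x := by
  rw [hb.hermiteSum_mulSeq_eq]
  refine ((hb.hasSum_hermiteFn x).const_smul x).unique ?_
  convert! ((hb.hasSum_lowerSeq x).add (hb.hasSum_raiseSeq x)).const_smul (√2)⁻¹ using 2 with k
  rw [smul_smul, mul_hermiteFn, ← add_smul, smul_smul]

theorem RapidDecay.hasDerivAt_hermiteSum {b : ℕ → E} (hb : RapidDecay b) (x : ℝ) :
    HasDerivAt (hermiteSum b) (hermiteSum (_root_.derivSeq b) x) x := by
  -- The ladder relation bounds |h_k'| by 2(k+1)² + 2(k+1)(k+2) ≤ 6(k+1)².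
  have h := hasDerivAt_tsum ((hb.summable 2).mul_left 6)
    (fun k y => (hasDerivAt_hermiteFn k y).smul_const (b k)) (fun k y => ?_)
    (hb.hasSum_hermiteFn 0).summable x
  · refine h.congr_deriv ?_
    rw [hb.hermiteSum_derivSeq_eq]
    refine HasSum.tsum_eq ?_
    convert! ((hb.hasSum_lowerSeq x).sub (hb.hasSum_raiseSeq x)).const_smul (√2)⁻¹ using 2 with k
    rw [← sub_smul, smul_smul]
  · rw [norm_smul, ← mul_assoc]
    gcongr
    have h1 : (√2)⁻¹ ≤ 1 := inv_le_one_of_one_le₀ (Real.one_le_sqrt.2 one_le_two)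
    have h2 : √(k : ℝ) ≤ k + 1 :=
      (Real.sqrt_le_sqrt (by linarith)).trans (sqrt_natCast_add_one_le k)
    have h3 := sqrt_natCast_add_one_le k
    have h4 := abs_hermiteFn_le (k - 1) y
    have h5 := abs_hermiteFn_le (k + 1) y
    have h6 : ((k - 1 : ℕ) : ℝ) ≤ k := by exact_mod_cast Nat.sub_le k 1
    rw [Real.norm_eq_abs, abs_mul, abs_of_nonneg (by positivity : 0 ≤ (√2)⁻¹)]
    calc _ ≤ 1 * (|√(k : ℝ) * hermiteFn (k - 1) y| + |√((k : ℝ) + 1) * hermiteFn (k + 1) y|) := by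
          gcongr
          exact abs_sub _ _
      _ ≤ 1 * (((k : ℝ) + 1) * (2 * ((k - 1 : ℕ) + 1)) +
          ((k : ℝ) + 1) * (2 * ((k + 1 : ℕ) + 1))) := by
          rw [abs_mul, abs_mul, abs_of_nonneg (Real.sqrt_nonneg _),
            abs_of_nonneg (Real.sqrt_nonneg _)]
          gcongr
      _ ≤ 1 * (((k : ℝ) + 1) * (2 * (k + 1)) + ((k : ℝ) + 1) * (2 * ((k + 1 : ℕ) + 1))) := by
          gcongr
      _ ≤ _ := by
          push_cast
          nlinarith [(Nat.cast_nonneg k : (0 : ℝ) ≤ k)]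

theorem RapidDecay.deriv_hermiteSum {b : ℕ → E} (hb : RapidDecay b) :
    deriv (hermiteSum b) = hermiteSum (_root_.derivSeq b) :=
  funext fun x => (hb.hasDerivAt_hermiteSum x).deriv

theorem RapidDecay.contDiff_hermiteSum (n : ℕ) {b : ℕ → E} (hb : RapidDecay b) :
    ContDiff ℝ n (hermiteSum b) := by
  induction n generalizing b with
  | zero =>
    exact contDiff_zero.2 (continuous_iff_continuousAt.2 fun x =>
      (hb.hasDerivAt_hermiteSum x).continuousAt)
  | succ n ih =>
    push_cast
    rw [contDiff_succ_iff_deriv]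
    refine ⟨fun x => (hb.hasDerivAt_hermiteSum x).differentiableAt, by simp, ?_⟩
    rw [hb.deriv_hermiteSum]
    exact ih hb.derivSeq

theorem RapidDecay.exists_iteratedDeriv_hermiteSum (n : ℕ) {b : ℕ → E} (hb : RapidDecay b) :
    ∃ d : ℕ → E, RapidDecay d ∧ iteratedDeriv n (hermiteSum b) = hermiteSum d := by
  induction n with
  | zero => exact ⟨b, hb, iteratedDeriv_zero⟩
  | succ n ih =>
    obtain ⟨d, hd, h⟩ := ih
    exact ⟨_root_.derivSeq d, hd.derivSeq, by rw [iteratedDeriv_succ, h, hd.deriv_hermiteSum]⟩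

theorem RapidDecay.exists_pow_smul_hermiteSum (n : ℕ) {b : ℕ → E} (hb : RapidDecay b) :
    ∃ d : ℕ → E, RapidDecay d ∧ ∀ x : ℝ, x ^ n • hermiteSum b x = hermiteSum d x := by
  induction n with
  | zero => exact ⟨b, hb, fun x => by simp⟩
  | succ n ih =>
    obtain ⟨d, hd, h⟩ := ih
    exact ⟨_root_.mulSeq d, hd.mulSeq, fun x => by
      rw [pow_succ', mul_smul, h, hd.smul_hermiteSum]⟩

/-- A Hermite series with rapidly decaying coefficients, as a Schwartz function. -/
noncomputable def RapidDecay.toSchwartz {b : ℕ → E} (hb : RapidDecay b) : SchwartzMap ℝ E where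
  toFun := hermiteSum b
  smooth' := contDiff_infty.2 fun n => hb.contDiff_hermiteSum n
  decay' k n := by
    obtain ⟨d, hd, h⟩ := hb.exists_iteratedDeriv_hermiteSum n
    obtain ⟨e, he, h'⟩ := hd.exists_pow_smul_hermiteSum k
    obtain ⟨C, hC⟩ := he.exists_norm_hermiteSum_le
    refine ⟨C, fun x => ?_⟩
    rw [norm_iteratedFDeriv_eq_norm_iteratedDeriv, h, ← norm_pow, ← norm_smul, h']
    exact hC x

theorem RapidDecay.coe_toSchwartz {b : ℕ → E} (hb : RapidDecay b) :
    (hb.toSchwartz : ℝ → E) = hermiteSum b := rfl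

theorem RapidDecay.integrable_hermiteSum {b : ℕ → E} (hb : RapidDecay b) :
    Integrable (hermiteSum b) :=
  hb.toSchwartz.integrable

theorem RapidDecay.hermiteCoeff_lowerSeq {b : ℕ → E} (hb : RapidDecay b) (k : ℕ) :
    hermiteCoeff k (hermiteSum (_root_.lowerSeq b)) =
      √((k : ℝ) + 1) • hermiteCoeff (k + 1) (hermiteSum b) := by
  have h0 : √2 ≠ 0 := by positivity
  have h2 : √2 * √2 = 2 := Real.mul_self_sqrt (by norm_num)
  have h : hermiteSum (_root_.lowerSeq b) = lowering hb.toSchwartz := by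
    funext x
    change _ = (√2)⁻¹ • (SchwartzMap.smulLeftCLM E (fun x : ℝ => x) hb.toSchwartz x +
      SchwartzMap.derivCLM ℝ E hb.toSchwartz x)
    rw [SchwartzMap.smulLeftCLM_apply_apply (by fun_prop), SchwartzMap.derivCLM_apply,
      hb.coe_toSchwartz, hb.deriv_hermiteSum, hb.smul_hermiteSum, hb.hermiteSum_mulSeq_eq,
      hb.hermiteSum_derivSeq_eq, ← smul_add, smul_smul, ← mul_inv, h2]
    module
  rw [h, hermiteCoeff_lowering, hb.coe_toSchwartz]

/-- Raising is adjoint to lowering, which kills h_0: the contributions of x and d/dx to coefficient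
0 are equal and cancel. -/
theorem RapidDecay.hermiteCoeff_zero_raiseSeq {b : ℕ → E} (hb : RapidDecay b) :
    hermiteCoeff 0 (hermiteSum (_root_.raiseSeq b)) = 0 := by
  have h2 : √2 * √2 = 2 := Real.mul_self_sqrt (by norm_num)
  have h : hermiteSum (_root_.raiseSeq b) = fun x =>
      (√2)⁻¹ • (hermiteSum (_root_.mulSeq b) x + (-1 : ℝ) • hermiteSum (_root_.derivSeq b) x) := by
    funext x
    rw [hb.hermiteSum_mulSeq_eq, hb.hermiteSum_derivSeq_eq, smul_comm, ← smul_add, smul_smul,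
      ← mul_inv, h2]
    module
  have h1 := hermiteCoeff_id_smul 0 hb.integrable_hermiteSum
  rw [funext hb.smul_hermiteSum] at h1
  have h3 := hermiteCoeff_hasDerivAt 0 hb.hasDerivAt_hermiteSum hb.integrable_hermiteSum
    hb.derivSeq.integrable_hermiteSum
  have hi : Integrable (fun x => (-1 : ℝ) • hermiteSum (_root_.derivSeq b) x) :=
    hb.derivSeq.integrable_hermiteSum.smul (-1 : ℝ)
  rw [h, hermiteCoeff_smul, hermiteCoeff_add 0 hb.mulSeq.integrable_hermiteSum hi,
    hermiteCoeff_smul, h1, h3]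
  simp

/-- Apart from its first term, the series is a raised one, which has coefficient 0; only ∫ h_0² = √π
remains. -/
theorem RapidDecay.hermiteCoeff_zero_hermiteSum {b : ℕ → E} (hb : RapidDecay b) :
    hermiteCoeff 0 (hermiteSum b) = √Real.pi • b 0 := by
  let d : ℕ → E := fun k => (√((k : ℝ) + 1))⁻¹ • b (k + 1)
  have hd : RapidDecay d := by
    intro p
    obtain ⟨C, hC⟩ := hb p
    refine ⟨C, fun k => le_trans ?_ (hC (k + 1))⟩
    have h1 : (√((k : ℝ) + 1))⁻¹ ≤ 1 := inv_le_one_of_one_le₀ (Real.one_le_sqrt.2 (by simp))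
    rw [norm_smul, Real.norm_of_nonneg (by positivity)]
    push_cast
    calc _ ≤ ((k : ℝ) + 1 + 1) ^ p * (1 * ‖b (k + 1)‖) := by gcongr; linarith
      _ = _ := by rw [one_mul]
  have h : hermiteSum b = fun x => hermiteFn 0 x • b 0 + hermiteSum (_root_.raiseSeq d) x := by
    funext x
    rw [hermiteSum, (hb.hasSum_hermiteFn x).summable.tsum_eq_zero_add]
    congr 1
    rw [← (hd.hasSum_raiseSeq x).tsum_eq]
    refine tsum_congr fun k => ?_
    have hk : √((k : ℝ) + 1) ≠ 0 := by positivity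
    rw [smul_smul, mul_right_comm, mul_inv_cancel₀ hk, one_mul]
  have hg : (fun x => hermiteFn 0 x * hermiteFn 0 x) = fun x => Real.exp (-1 * x ^ 2) := by
    funext x
    rw [hermiteFn_zero, ← Real.exp_add]
    ring_nf
  have hi : Integrable (fun x => hermiteFn 0 x) := by
    convert! integrable_exp_neg_mul_sq (b := 1 / 2) (by norm_num) using 2 with x
    rw [hermiteFn_zero]
    ring_nf
  rw [h, hermiteCoeff_add 0 (hi.smul_const _) hd.raiseSeq.integrable_hermiteSum,
    hd.hermiteCoeff_zero_raiseSeq, add_zero, hermiteCoeff]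
  simp only [smul_smul]
  rw [integral_smul_const, hg, integral_gaussian, div_one]

/-- Lowering shifts the index on both sides with the same factor √(k+1), so everything reduces to k
= 0. -/
theorem RapidDecay.hermiteCoeff_hermiteSum (k : ℕ) {b : ℕ → E} (hb : RapidDecay b) :
    hermiteCoeff k (hermiteSum b) = √Real.pi • b k := by
  induction k generalizing b with
  | zero => exact hb.hermiteCoeff_zero_hermiteSum
  | succ k ih =>
    have hk : √((k : ℝ) + 1) ≠ 0 := by positivity
    have h := hb.hermiteCoeff_lowerSeq k
    rw [ih hb.lowerSeq, _root_.lowerSeq, smul_comm] at h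
    exact (smul_right_injective E hk h).symm

end HermiteSeries

/-! ### Uniqueness of coefficients and slice regularity. -/

theorem eq_of_hasSum_real_pow_smul {E : Type*} [NormedAddCommGroup E] [NormedSpace ℝ E]
    {a b : ℕ → E} {g : ℝ → E} (ha : ∀ t : ℝ, HasSum (fun k => t ^ k • a k) (g t))
    (hb : ∀ t : ℝ, HasSum (fun k => t ^ k • b k) (g t)) : a = b := by
  let p (c : ℕ → E) : FormalMultilinearSeries ℝ ℝ E :=
    fun n => ContinuousMultilinearMap.mkPiRing ℝ (Fin n) (c n)
  have hp (c : ℕ → E) (n : ℕ) : (p c).coeff n = c n := by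
    simp [p, FormalMultilinearSeries.coeff]
  have key {c : ℕ → E} (hc : ∀ t : ℝ, HasSum (fun k => t ^ k • c k) (g t)) :
      HasFPowerSeriesAt g (p c) 0 :=
    hasFPowerSeriesAt_iff.2 (.of_forall fun z => by simpa only [hp, zero_add] using hc z)
  have h := (key ha).eq_formalMultilinearSeries (key hb)
  funext n
  rw [← hp a, h, hp]

theorem FactorialDecay.summable_norm_mul_pow' {c : ℕ → ℍ[ℝ]} (h : FactorialDecay c) {r : ℝ}
    (hr : 0 ≤ r) : Summable (fun k : ℕ => ‖c k‖ * r ^ k) := by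
  refine Summable.of_nonneg_of_le (fun k => by positivity) (fun k => ?_)
    (h.summable_norm_mul_pow hr)
  have : 0 ≤ ‖c k‖ * r ^ k := by positivity
  nlinarith [(Nat.cast_nonneg k : (0 : ℝ) ≤ k)]

theorem FactorialDecay.summable_pow_mul {c : ℕ → ℍ[ℝ]} (h : FactorialDecay c) (q : ℍ[ℝ]) :
    Summable (fun k : ℕ => q ^ k * c k) := by
  refine Summable.of_norm_bounded (h.summable_norm_mul_pow' (norm_nonneg q)) fun k => ?_
  rw [norm_mul, norm_pow, mul_comm]

/-- The formal multilinear series of `q ↦ ∑ q ^ k * c k`. -/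
noncomputable def leftPowerSeries (c : ℕ → ℍ[ℝ]) : FormalMultilinearSeries ℝ ℍ[ℝ] ℍ[ℝ] := fun n =>
  ((ContinuousLinearMap.mul ℝ ℍ[ℝ]).flip (c n)).compContinuousMultilinearMap
    (ContinuousMultilinearMap.mkPiAlgebraFin ℝ n ℍ[ℝ])

theorem FactorialDecay.hasFPowerSeriesOnBall {c : ℕ → ℍ[ℝ]} (h : FactorialDecay c)
    {f : ℍ[ℝ] → ℍ[ℝ]} (hf : ∀ q : ℍ[ℝ], HasSum (fun k : ℕ => q ^ k * c k) (f q)) :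
    HasFPowerSeriesOnBall f (leftPowerSeries c) 0 ⊤ where
  r_le := by
    rw [FormalMultilinearSeries.radius_eq_top_of_summable_norm]
    intro r
    refine Summable.of_nonneg_of_le (fun k => by positivity) (fun k => ?_)
      (h.summable_norm_mul_pow' r.2)
    refine mul_le_mul_of_nonneg_right ?_ (by positivity)
    refine (ContinuousLinearMap.norm_compContinuousMultilinearMap_le _ _).trans ?_
    rw [ContinuousMultilinearMap.norm_mkPiAlgebraFin, mul_one,
      ContinuousLinearMap.opNorm_mul_flip_apply]
  r_pos := by simp
  hasSum := by
    intro y _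
    simpa [leftPowerSeries] using hf y

theorem FactorialDecay.contDiff {c : ℕ → ℍ[ℝ]} (h : FactorialDecay c)
    {f : ℍ[ℝ] → ℍ[ℝ]} (hf : ∀ q : ℍ[ℝ], HasSum (fun k : ℕ => q ^ k * c k) (f q)) :
    ContDiff ℝ 1 f := by
  have := (h.hasFPowerSeriesOnBall hf).analyticOnNhd
  rw [Metric.eball_top] at this
  exact contDiffOn_univ.1 (this.contDiffOn uniqueDiffOn_univ)

/-- The usual power rule survives noncommutativity along lines whose direction commutes with the
base point. -/
theorem hasDerivAt_add_smul_pow {q v : ℍ[ℝ]} (hqv : Commute q v) (k : ℕ) (t : ℝ) :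
    HasDerivAt (fun t : ℝ => (q + t • v) ^ k) (k • ((q + t • v) ^ (k - 1) * v)) t := by
  induction k with
  | zero => simpa using hasDerivAt_const t (1 : ℍ[ℝ])
  | succ k ih =>
    have hl : HasDerivAt (fun t : ℝ => q + t • v) v t := by
      simpa using ((hasDerivAt_id t).smul_const v).const_add q
    have hc : (q + t • v) * v = v * (q + t • v) :=
      (hqv.add_left ((Commute.refl v).smul_left t)).eq
    simp only [pow_succ]
    refine (ih.mul hl).congr_deriv ?_
    rcases k with _ | k
    · simp
    · simp only [Nat.add_sub_cancel, smul_mul_assoc, mul_assoc, ← hc, pow_succ]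
      exact (succ_nsmul _ _).symm

theorem FactorialDecay.hasDerivAt_line {c : ℕ → ℍ[ℝ]} (h : FactorialDecay c)
    {f : ℍ[ℝ] → ℍ[ℝ]} (hf : ∀ q : ℍ[ℝ], HasSum (fun k : ℕ => q ^ k * c k) (f q))
    {q v : ℍ[ℝ]} (hqv : Commute q v) (t : ℝ) :
    HasDerivAt (fun t : ℝ => f (q + t • v))
      (∑' k : ℕ, k • ((q + t • v) ^ (k - 1) * v) * c k) t := by
  have hfe : (fun t : ℝ => f (q + t • v)) = fun t : ℝ => ∑' k : ℕ, (q + t • v) ^ k * c k :=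
    funext fun t => (hf _).tsum_eq.symm
  rw [hfe]
  -- R bounds ‖q + s • v‖ for |s| ≤ |t| + 1; the final 1 gives R ≥ 1, so R^(k-1) ≤ R^k.
  set R : ℝ := ‖q‖ + (|t| + 1) * ‖v‖ + 1 with hR
  have hR1 : 1 ≤ R := by
    have : 0 ≤ ‖q‖ + (|t| + 1) * ‖v‖ := by positivity
    linarith
  have ht : t ∈ Metric.ball (0 : ℝ) (|t| + 1) := by simp
  refine hasDerivAt_tsum_of_isPreconnected
    ((h.summable_norm_mul_pow (zero_le_one.trans hR1)).mul_left ‖v‖) Metric.isOpen_ball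
    (convex_ball 0 (|t| + 1)).isPreconnected
    (fun k s _ => (hasDerivAt_add_smul_pow hqv k s).mul_const (c k)) (fun k s hs => ?_) ht
    (hf _).summable ht
  have hs' : |s| ≤ |t| + 1 := by
    rw [mem_ball_zero_iff] at hs
    exact hs.le
  have hQ : ‖q + s • v‖ ≤ R := by
    calc _ ≤ ‖q‖ + ‖s • v‖ := norm_add_le _ _
      _ ≤ ‖q‖ + (|t| + 1) * ‖v‖ := by rw [norm_smul]; gcongr; exact hs'
      _ ≤ R := by linarith
  calc _ ≤ (k * (‖q + s • v‖ ^ (k - 1) * ‖v‖)) * ‖c k‖ := by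
        rw [norm_mul _ (c k), ← norm_pow, ← norm_mul _ v]
        exact mul_le_mul_of_nonneg_right norm_nsmul_le (norm_nonneg _)
    _ ≤ ((k + 1) * (R ^ k * ‖v‖)) * ‖c k‖ := by
        gcongr
        · linarith
        · exact (pow_le_pow_left₀ (norm_nonneg _) hQ _).trans
            (pow_le_pow_right₀ hR1 (Nat.sub_le k 1))
    _ = _ := by ring

/-- Within a slice, I commutes with Q = x + Iy, so termwise the y-derivative is the x-derivative
with I inserted left of c_k; moving I to the front and using I² = -1 cancels the two. -/
theorem FactorialDecay.isSliceRegular {c : ℕ → ℍ[ℝ]} (h : FactorialDecay c)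
    {f : ℍ[ℝ] → ℍ[ℝ]} (hf : ∀ q : ℍ[ℝ], HasSum (fun k : ℕ => q ^ k * c k) (f q)) :
    IsSliceRegular f := by
  have hcd := h.contDiff hf
  refine ⟨hcd.differentiable (by simp), fun I hI => ⟨?_, fun x y => ?_⟩⟩
  · have hs (z : ℝ × ℝ) : (z.1 : ℍ[ℝ]) + I * (z.2 : ℍ[ℝ]) = z.1 • (1 : ℍ[ℝ]) + z.2 • I := by
      rw [Quaternion.mul_coe_eq_smul, ← Quaternion.coe_one, Quaternion.smul_coe, mul_one]
    simp only [hs]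
    exact hcd.comp ((contDiff_fst.smul contDiff_const).add (contDiff_snd.smul contDiff_const))
  have hx := h.hasDerivAt_line hf (Commute.one_right (I * (y : ℍ[ℝ]))) x
  have hy := h.hasDerivAt_line hf (Quaternion.coe_commute x I) y
  have ex (s : ℝ) : I * (y : ℍ[ℝ]) + s • (1 : ℍ[ℝ]) = (s : ℍ[ℝ]) + I * (y : ℍ[ℝ]) := by
    rw [add_comm, ← Quaternion.coe_one, Quaternion.smul_coe, mul_one]
  have ey (t : ℝ) : (x : ℍ[ℝ]) + t • I = (x : ℍ[ℝ]) + I * (t : ℍ[ℝ]) := by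
    rw [Quaternion.mul_coe_eq_smul]
  simp only [ex] at hx
  simp only [ey] at hy
  rw [hx.deriv, hy.deriv, ← tsum_mul_left]
  set Q := (x : ℍ[ℝ]) + I * (y : ℍ[ℝ])
  have hc : Commute I Q := (Quaternion.coe_commute x I).symm.add_right
    ((Commute.refl I).mul_right (Quaternion.coe_commute y I).symm)
  have : ∀ k : ℕ, I * (k • (Q ^ (k - 1) * I) * c k) = -(k • (Q ^ (k - 1) * 1) * c k) := by
    intro k
    rw [smul_mul_assoc, mul_smul_comm, ← mul_assoc, ← mul_assoc, (hc.pow_right (k - 1)).eq,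
      mul_assoc (Q ^ (k - 1)), ← pow_two, hI, smul_mul_assoc]
    simp
  simp only [this, tsum_neg, add_neg_cancel, smul_zero]

/-! ### Conclusion. -/

theorem mem_schwartzFock_iff_factorialDecay {f : ℍ[ℝ] → ℍ[ℝ]} {c : ℕ → ℍ[ℝ]}
    (hf : ∀ q : ℍ[ℝ], HasSum (fun k : ℕ => q ^ k * c k) (f q)) :
    f ∈ schwartzFock ↔ FactorialDecay c := by
  have hf0 (k : ℕ) : √(k.factorial : ℝ) ≠ 0 := by positivity
  constructor
  · rintro ⟨ψ, rfl⟩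
    have hreal {d : ℕ → ℍ[ℝ]}
        (hd : ∀ q : ℍ[ℝ], HasSum (fun k : ℕ => q ^ k * d k) (segalBargmann 1 (fun x => ψ x) q))
        (t : ℝ) : HasSum (fun k => t ^ k • d k) (segalBargmann 1 (fun x => ψ x) (t : ℍ[ℝ])) := by
      simpa only [← Quaternion.coe_pow, Quaternion.coe_mul_eq_smul] using hd t
    rw [factorialDecay_iff_rapidDecay,
      eq_of_hasSum_real_pow_smul (hreal hf) (hreal (hasSum_segalBargmann ψ))]
    simp only [smul_smul, mul_div_cancel₀ _ (hf0 _)]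
    exact (rapidDecay_hermiteCoeff ψ).const_smul _
  · intro h
    set κ : ℝ := (1 / Real.pi) ^ (3 / 4 : ℝ)
    have hκ : κ ≠ 0 := by positivity
    have hπ : √Real.pi ≠ 0 := by positivity
    -- The scaling undoes the kernel constant κ and the factor √π by which a Hermite series'
    -- coefficients are recovered.
    have hb := ((factorialDecay_iff_rapidDecay c).1 h).const_smul (κ * √Real.pi)⁻¹
    refine ⟨hb.toSchwartz, funext fun q => ?_⟩
    refine (hasSum_segalBargmann hb.toSchwartz q).unique ?_
    convert! hf q using 3 with k
    rw [hb.coe_toSchwartz, hb.hermiteCoeff_hermiteSum, smul_smul, smul_smul, smul_smul]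
    have := hf0 k
    convert! one_smul ℝ (c k)
    field_simp
    rfl

theorem mainTheorem8 :
    (∀ c : ℕ → ℍ[ℝ], FactorialDecay c → ∀ q : ℍ[ℝ], Summable (fun k : ℕ => q ^ k * c k)) ∧
    (∀ (f : ℍ[ℝ] → ℍ[ℝ]) (c : ℕ → ℍ[ℝ]),
      (∀ q : ℍ[ℝ], HasSum (fun k : ℕ => q ^ k * c k) (f q)) →
        (f ∈ schwartzFock ↔ FactorialDecay c)) ∧
    schwartzFock =
      {f : ℍ[ℝ] → ℍ[ℝ] | IsSliceRegular f ∧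
        ∃ c : ℕ → ℍ[ℝ], FactorialDecay c ∧
          ∀ q : ℍ[ℝ], HasSum (fun k : ℕ => q ^ k * c k) (f q)} := by
  refine ⟨fun c hc q => hc.summable_pow_mul q,
    fun f c hf => mem_schwartzFock_iff_factorialDecay hf, Set.ext fun f => ⟨fun h => ?_, ?_⟩⟩
  · obtain ⟨ψ, rfl⟩ := id h
    have hf := hasSum_segalBargmann ψ
    have hc := (mem_schwartzFock_iff_factorialDecay hf).1 h
    exact ⟨hc.isSliceRegular hf, _, hc, hf⟩
  · rintro ⟨-, c, hc, hf⟩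
    exact (mem_schwartzFock_iff_factorialDecay hf).2 hc
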